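/- Let $R$ be a commutative ring with $1\neq 0$, let $E=(E^0,E^1,r,s)$ be a directed graph ($E^0$ and $E^1$ of arbitrary cardinality), and let $n\geq 1$ be an integer. A vertex of $E$ is called singular if it emits no edges or emits infinitely many edges. Let $L_R(E)$ be the Leavitt path algebra, i.e. the universal associative (not necessarily unital) $R$-algebra generated by elements $v$ ($v\in E^0$) and $e,e^*$ ($e\in E^1$) such that the $v$ are pairwise orthogonal idempotents, $s(e)e=e\,r(e)=e$ and $e^*s(e)=r(e)e^*=e^*$ for all $e\in E^1$, $e^*f=\delta_{e,f}\,r(e)$ for all $e,f\in E^1$, and $v=\sum_{e\in s^{-1}(v)}ee^*$ for every non-singular $v\in E^0$. A path of length $m$ is a sequence $\alpha=\alpha_1\cdots\alpha_m$ of edges with $r(\alpha_i)=s(\alpha_{i+1})$, and it is received by $r(\alpha)=r(\alpha_m)$; paths of length $0$ are the vertices. Write $\alpha^*=\alpha_m^*\cdots\alpha_1^*$, and $v^*=v$ for $v\in E^0$. Give $L_R(E)$ its canonical $\mathbb Z$-grading, where $$L_R(E)_k=\operatorname{span}_R\{\alpha\beta^* : \alpha,\beta \text{ finite paths},\ r(\alpha)=r(\beta),\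 |\alpha|-|\beta|=k\},$$ and the quotient $\mathbb Z/n\mathbb Z$-grading, where $L_R(E)_{[k]}=\bigoplus_{j\equiv k \bmod n}L_R(E)_j$. Then $L_R(E)$ is strongly $\mathbb Z/n\mathbb Z$-graded, i.e. it is graded by the components $L_R(E)_{[k]}$ and for all $[k],[l]\in\mathbb Z/n\mathbb Z$ the additive subgroup generated by the products $xy$ with $x\in L_R(E)_{[k]}$ and $y\in L_R(E)_{[l]}$ equals $L_R(E)_{[k+l]}$, if and only if every singular vertex of $E$ receives a path of length $n-1$. -/

import Mathlib

/-! A directed graph `E = (E⁰, E¹, r, s)` is a quiver on the type `V = E⁰`; the type of all its edges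
is `E¹ = Quiver.Total V`, where an edge `e` has source `e.left` and range `e.right`.  Paths are
`Quiver.Path`: the range of each edge is the source of the next one, and the path of length `0`
at a vertex is that vertex.  Vertex and edge sets have arbitrary cardinality. -/

universe u v w

open scoped Classical in
/-- The family `𝒜` makes `A` a graded algebra: `A` is the internal direct sum of the submodules
`𝒜 γ`, and `𝒜 γ * 𝒜 δ ⊆ 𝒜 (γ + δ)`.  The algebra `A` need not have a unit. -/
def IsAlgebraGrading {R A Γ : Type*} [CommRing R] [NonUnitalRing A] [Module R A]
    [AddGroup Γ] (𝒜 : Γ → Submodule R A) : Prop :=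
  DirectSum.IsInternal 𝒜 ∧ ∀ γ δ : Γ, ∀ x ∈ 𝒜 γ, ∀ y ∈ 𝒜 δ, x * y ∈ 𝒜 (γ + δ)

/-- `A` is strongly graded by `𝒜`: it is graded, and for all `γ, δ` the additive subgroup
generated by the products of an element of `𝒜 γ` and an element of `𝒜 δ` is `𝒜 (γ + δ)`. -/
def IsStronglyGraded {R A Γ : Type*} [CommRing R] [NonUnitalRing A] [Module R A]
    [AddGroup Γ] (𝒜 : Γ → Submodule R A) : Prop :=
  IsAlgebraGrading 𝒜 ∧ ∀ γ δ : Γ,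
    AddSubgroup.closure {z : A | ∃ x ∈ 𝒜 γ, ∃ y ∈ 𝒜 δ, x * y = z} = (𝒜 (γ + δ)).toAddSubgroup

/-- The quotient grading: the component of a coset `q ∈ Γ ⧸ Ω` is the sum of the `𝒜 γ` over all
`γ` in `q`. -/
def quotientGrading {R A Γ : Type*} [CommRing R] [NonUnitalRing A] [Module R A]
    [AddGroup Γ] (𝒜 : Γ → Submodule R A) (Ω : AddSubgroup Γ) (q : Γ ⧸ Ω) : Submodule R A :=
  ⨆ (γ : Γ) (_ : (γ : Γ ⧸ Ω) = q), 𝒜 γ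

section Graph

variable {V : Type u} [Quiver.{v} V]

/-- A sink emits no edges. -/
def IsSink (x : V) : Prop := IsEmpty (Quiver.Star x)

/-- An infinite emitter emits infinitely many edges. -/
def IsInfiniteEmitter (x : V) : Prop := Infinite (Quiver.Star x)

/-- A vertex is singular if it is a sink or an infinite emitter. -/
def IsSingularVertex (x : V) : Prop := IsSink x ∨ IsInfiniteEmitter x

end Graph

noncomputable section

section Leavitt

variable (R : Type w) [CommRing R] (V : Type u) [Quiver.{v} V]

/-- The generators `x`, `e`, `e*` of the Leavitt path algebra, for `x ∈ E⁰` and `e ∈ E¹`. -/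
inductive LeavittGenerator : Type (max u v)
  | vertex (x : V) : LeavittGenerator
  | edge (e : Quiver.Total V) : LeavittGenerator
  | ghost (e : Quiver.Total V) : LeavittGenerator

/-- The free associative (non-unital) `R`-algebra on the generators. -/
abbrev LeavittFree : Type (max u v w) := MonoidAlgebra R (FreeSemigroup (LeavittGenerator V))

variable {V} in
/-- A generator as an element of the free algebra. -/
def LeavittFree.of (g : LeavittGenerator V) : LeavittFree R V :=
  MonoidAlgebra.single (FreeSemigroup.of g) 1

open LeavittGenerator LeavittFree in
/-- The defining relations of a Leavitt `E`-family: the vertices are pairwise orthogonal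
idempotents, (E1), (E2), (CK1), and (CK2) at the vertices that are not singular. -/
inductive LeavittRel : LeavittFree R V → LeavittFree R V → Prop
  | vertex_idem (x : V) : LeavittRel (of R (vertex x) * of R (vertex x)) (of R (vertex x))
  | vertex_orth (x y : V) : x ≠ y → LeavittRel (of R (vertex x) * of R (vertex y)) 0
  | source_edge (e : Quiver.Total V) :
      LeavittRel (of R (vertex e.left) * of R (edge e)) (of R (edge e))
  | edge_range (e : Quiver.Total V) :
      LeavittRel (of R (edge e) * of R (vertex e.right)) (of R (edge e))
  | ghost_source (e : Quiver.Total V) :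
      LeavittRel (of R (ghost e) * of R (vertex e.left)) (of R (ghost e))
  | range_ghost (e : Quiver.Total V) :
      LeavittRel (of R (vertex e.right) * of R (ghost e)) (of R (ghost e))
  | ghost_edge_self (e : Quiver.Total V) :
      LeavittRel (of R (ghost e) * of R (edge e)) (of R (vertex e.right))
  | ghost_edge_ne (e f : Quiver.Total V) : e ≠ f →
      LeavittRel (of R (ghost e) * of R (edge f)) 0
  | vertex_sum (x : V) : ¬ IsSingularVertex x →
      LeavittRel (of R (vertex x))
        (∑ᶠ e : Quiver.Star x, of R (edge ⟨x, e.1, e.2⟩) * of R (ghost ⟨x, e.1, e.2⟩))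

/-- The least congruence of `R`-algebras that contains the relations.  Scalar multiples of the
relations are added because the free algebra has no unit. -/
def leavittCon : RingCon (LeavittFree R V) :=
  ringConGen fun a b => ∃ (r : R) (x y : LeavittFree R V), LeavittRel R V x y ∧
    a = r • x ∧ b = r • y

variable {R V} in
theorem leavittCon_smul (r : R) {a b : LeavittFree R V} (h : leavittCon R V a b) :
    leavittCon R V (r • a) (r • b) := by
  change RingConGen.Rel _ a b at h
  change RingConGen.Rel _ (r • a) (r • b)
  induction h with
  | of a b h =>
    obtain ⟨s, x, y, hxy, rfl, rfl⟩ := h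
    exact .of _ _ ⟨r * s, x, y, hxy, smul_smul .., smul_smul ..⟩
  | refl x => exact .refl _
  | symm _ ih => exact .symm ih
  | trans _ _ ih₁ ih₂ => exact .trans ih₁ ih₂
  | add _ _ ih₁ ih₂ => simpa only [smul_add] using RingConGen.Rel.add ih₁ ih₂
  | mul _ h₂ ih₁ _ => simpa only [smul_mul_assoc] using RingConGen.Rel.mul ih₁ h₂

/-- The Leavitt path algebra `L_R(E)`: the universal (not necessarily unital) associative
`R`-algebra generated by a Leavitt `E`-family. -/
def LeavittPathAlgebra : Type (max u v w) := (leavittCon R V).Quotient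

namespace LeavittPathAlgebra

/-- The quotient map from the free algebra. -/
def mk (a : LeavittFree R V) : LeavittPathAlgebra R V := (a : (leavittCon R V).Quotient)

instance : NonUnitalRing (LeavittPathAlgebra R V) :=
  { (inferInstance : NonUnitalNonAssocRing (leavittCon R V).Quotient) with
    mul_assoc := by
      rintro ⟨a⟩ ⟨b⟩ ⟨c⟩
      exact congrArg (mk R V) (mul_assoc a b c) }

instance : SMul R (LeavittPathAlgebra R V) where
  smul r := Quotient.map' (r • ·) fun _ _ h => leavittCon_smul r h

instance : Module R (LeavittPathAlgebra R V) where
  one_smul := by rintro ⟨a⟩; exact congrArg (mk R V) (one_smul R a)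
  mul_smul := by rintro r s ⟨a⟩; exact congrArg (mk R V) (mul_smul r s a)
  smul_zero := fun r => congrArg (mk R V) (smul_zero r)
  smul_add := by rintro r ⟨a⟩ ⟨b⟩; exact congrArg (mk R V) (smul_add r a b)
  add_smul := by rintro r s ⟨a⟩; exact congrArg (mk R V) (add_smul r s a)
  zero_smul := by rintro ⟨a⟩; exact congrArg (mk R V) (zero_smul R a)

instance : IsScalarTower R (LeavittPathAlgebra R V) (LeavittPathAlgebra R V) where
  smul_assoc := by rintro r ⟨a⟩ ⟨b⟩; exact congrArg (mk R V) (smul_mul_assoc r a b)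

instance : SMulCommClass R (LeavittPathAlgebra R V) (LeavittPathAlgebra R V) where
  smul_comm := by rintro r ⟨a⟩ ⟨b⟩; exact congrArg (mk R V) (mul_smul_comm r a b).symm

variable {V}

/-- The element `x` of `L_R(E)` for a vertex `x`. -/
def vertex (x : V) : LeavittPathAlgebra R V := mk R V (LeavittFree.of R (.vertex x))

/-- The element `e` of `L_R(E)` for an edge `e`. -/
def edge (e : Quiver.Total V) : LeavittPathAlgebra R V := mk R V (LeavittFree.of R (.edge e))

/-- The element `e*` of `L_R(E)` for an edge `e`. -/
def ghost (e : Quiver.Total V) : LeavittPathAlgebra R V := mk R V (LeavittFree.of R (.ghost e))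

/-- The element `α = α₁ ⋯ αₙ` of `L_R(E)` for a path `α`; it is the vertex `a` if `n = 0`. -/
def ofPath {a : V} : {b : V} → Quiver.Path a b → LeavittPathAlgebra R V
  | _, .nil => vertex R a
  | _, .cons (b := b) (c := c) p e => ofPath p * edge R ⟨b, c, e⟩

/-- The element `α* = αₙ* ⋯ α₁*` of `L_R(E)` for a path `α`; it is the vertex `a` if `n = 0`. -/
def ofPathStar {a : V} : {b : V} → Quiver.Path a b → LeavittPathAlgebra R V
  | _, .nil => vertex R a
  | _, .cons (b := b) (c := c) p e => ghost R ⟨b, c, e⟩ * ofPathStar p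

variable (V)

/-- The canonical `ℤ`-grading: the component of degree `n` is spanned by the elements `α β*`
for paths `α` and `β` with `r(α) = r(β)` and `|α| - |β| = n`. -/
def grading (n : ℤ) : Submodule R (LeavittPathAlgebra R V) :=
  Submodule.span R {z | ∃ (a b c : V) (α : Quiver.Path a c) (β : Quiver.Path b c),
    (α.length : ℤ) - (β.length : ℤ) = n ∧ z = ofPath R α * ofPathStar R β}

end LeavittPathAlgebra

end Leavitt

end

/-! Write `Ω = nℤ` and `L_q` for the component of `L_R(E)` in degree `q ∈ ℤ/n`.

*Gradedness.*  The span of the products `α β*` is stable under left multiplication by generators,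
so these products span the algebra and their degrees add up (`mul_mem_cosetComponent`).  The
components are independent because multiplying each generator by the group element of its degree
gives a Leavitt family in the group algebra of `ℤ/n` over the unitization of `L_R(E)`; the induced
homomorphism separates the components (`degreeHom_of_mem`).

*Sufficiency.*  As the vertices are local units, it is enough that every vertex lies in
`L_q L_{-q}` for all `q` (`isStronglyGraded_of_vertex_mem`), and by iteration it is enough to treat
`q = 1`.  A regular vertex is `∑ e e*`; a singular vertex that receives a path `α` of length `n - 1`
is `α* α`, and `α*` has degree `-(n - 1) ≡ 1`.

*Necessity.*  Let `x` be singular without a path of length `n - 1` ending at `x`.  In a product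
`α β*` of degree `1` modulo `n`, the path `α` is not the vertex `x`, since otherwise `β` would end at
`x` and have length at least `n - 1`.  So every element of `L_1`, and hence of `L_1 L_{-1}`, is
annihilated on the left by `x` if `x` is a sink, and otherwise by `e*` for all but finitely many
edges `e` leaving `x` (`cosetComponent_one_le_cofiniteAnnihilated`).  The vertex `x` does not have
this property, because vertices are nonzero (`vertex_ne_zero`).  The latter follows from a
representation on the free module on `V × D` for an infinite set `D` so large that
`s⁻¹(x) × D ≃ D` for each vertex `x` that emits edges. -/

noncomputable section

/-! ### The universal property -/

/-- A Leavitt `E`-family in an `R`-algebra `A`: a choice of images in `A` for the generators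
`x`, `e`, `e*` that satisfies the defining relations of the Leavitt path algebra.  The
`finsum` in the last relation is over a finite type, as `x` is not singular. -/
structure IsLeavittFamily {V : Type u} [Quiver.{v} V] {A : Type*} [NonUnitalRing A]
    (f : LeavittGenerator V → A) : Prop where
  vertex_idem (x : V) : f (.vertex x) * f (.vertex x) = f (.vertex x)
  vertex_orth (x y : V) (h : x ≠ y) : f (.vertex x) * f (.vertex y) = 0
  source_edge (e : Quiver.Total V) : f (.vertex e.left) * f (.edge e) = f (.edge e)
  edge_range (e : Quiver.Total V) : f (.edge e) * f (.vertex e.right) = f (.edge e)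
  ghost_source (e : Quiver.Total V) : f (.ghost e) * f (.vertex e.left) = f (.ghost e)
  range_ghost (e : Quiver.Total V) : f (.vertex e.right) * f (.ghost e) = f (.ghost e)
  ghost_edge_self (e : Quiver.Total V) : f (.ghost e) * f (.edge e) = f (.vertex e.right)
  ghost_edge_ne (e e' : Quiver.Total V) (h : e ≠ e') : f (.ghost e) * f (.edge e') = 0
  vertex_sum (x : V) (h : ¬ IsSingularVertex x) :
    f (.vertex x) = ∑ᶠ e : Quiver.Star x, f (.edge ⟨x, e.1, e.2⟩) * f (.ghost ⟨x, e.1, e.2⟩)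

theorem finite_star_of_not_isSingularVertex {V : Type u} [Quiver.{v} V] {x : V}
    (h : ¬ IsSingularVertex x) : Finite (Quiver.Star x) :=
  not_infinite_iff_finite.1 fun h' => h (.inr h')

namespace LeavittPathAlgebra

section Lift

variable {R : Type w} [CommRing R] {V : Type u} [Quiver.{v} V]
  {A : Type*} [NonUnitalRing A] [Module R A] [IsScalarTower R A A] [SMulCommClass R A A]

variable (R) in
/-- The homomorphism from the free algebra that sends each generator `g` to `f g`. -/
def freeLift (f : LeavittGenerator V → A) : LeavittFree R V →ₙₐ[R] A :=
  MonoidAlgebra.liftMagma R (FreeSemigroup.lift f)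

theorem freeLift_of (f : LeavittGenerator V → A) (g : LeavittGenerator V) :
    freeLift R f (LeavittFree.of R g) = f g := by
  simp [freeLift, LeavittFree.of, MonoidAlgebra.liftMagma]

theorem freeLift_eq_of_leavittRel {f : LeavittGenerator V → A} (hf : IsLeavittFamily f)
    {a b : LeavittFree R V} (h : LeavittRel R V a b) : freeLift R f a = freeLift R f b := by
  cases h with
  | vertex_idem x => simpa only [map_mul, freeLift_of] using hf.vertex_idem x
  | vertex_orth x y h => simpa only [map_mul, map_zero, freeLift_of] using hf.vertex_orth x y h
  | source_edge e => simpa only [map_mul, freeLift_of] using hf.source_edge e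
  | edge_range e => simpa only [map_mul, freeLift_of] using hf.edge_range e
  | ghost_source e => simpa only [map_mul, freeLift_of] using hf.ghost_source e
  | range_ghost e => simpa only [map_mul, freeLift_of] using hf.range_ghost e
  | ghost_edge_self e => simpa only [map_mul, freeLift_of] using hf.ghost_edge_self e
  | ghost_edge_ne e e' h =>
    simpa only [map_mul, map_zero, freeLift_of] using hf.ghost_edge_ne e e' h
  | vertex_sum x h =>
    have := finite_star_of_not_isSingularVertex h
    rw [map_finsum _ (Set.toFinite _)]
    simpa only [map_mul, freeLift_of] using hf.vertex_sum x h

theorem freeLift_eq_of_leavittCon {f : LeavittGenerator V → A} (hf : IsLeavittFamily f)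
    {a b : LeavittFree R V} (h : leavittCon R V a b) : freeLift R f a = freeLift R f b := by
  change RingConGen.Rel _ a b at h
  induction h with
  | of a b h =>
    obtain ⟨r, x, y, hxy, rfl, rfl⟩ := h
    rw [map_smul, map_smul, freeLift_eq_of_leavittRel hf hxy]
  | refl x => rfl
  | symm _ ih => exact ih.symm
  | trans _ _ ih₁ ih₂ => exact ih₁.trans ih₂
  | add _ _ ih₁ ih₂ => rw [map_add, map_add, ih₁, ih₂]
  | mul _ _ ih₁ ih₂ => rw [map_mul, map_mul, ih₁, ih₂]

variable (R) in
/-- The homomorphism from `L_R(E)` induced by a Leavitt `E`-family. -/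
def lift {f : LeavittGenerator V → A} (hf : IsLeavittFamily f) :
    LeavittPathAlgebra R V →ₙₐ[R] A where
  toFun := Quotient.lift (freeLift R f) fun _ _ h => freeLift_eq_of_leavittCon hf h
  map_smul' := by rintro r ⟨a⟩; exact map_smul (freeLift R f) r a
  map_zero' := map_zero (freeLift R f)
  map_add' := by rintro ⟨a⟩ ⟨b⟩; exact map_add (freeLift R f) a b
  map_mul' := by rintro ⟨a⟩ ⟨b⟩; exact map_mul (freeLift R f) a b

theorem lift_mk_of {f : LeavittGenerator V → A} (hf : IsLeavittFamily f)
    (g : LeavittGenerator V) : lift R hf (mk R V (LeavittFree.of R g)) = f g :=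
  freeLift_of f g

end Lift

section Relations

variable (R : Type w) [CommRing R] {V : Type u} [Quiver.{v} V]

variable (V) in
/-- The quotient map as a homomorphism of additive groups. -/
def mkHom : LeavittFree R V →+ LeavittPathAlgebra R V where
  toFun := mk R V
  map_zero' := rfl
  map_add' _ _ := rfl

theorem mk_eq_of_leavittRel {a b : LeavittFree R V} (h : LeavittRel R V a b) :
    mk R V a = mk R V b :=
  (RingCon.eq _).2 <| .of _ _ ⟨1, a, b, h, (one_smul R a).symm, (one_smul R b).symm⟩

/-- The generators of `L_R(E)` form a Leavitt `E`-family. -/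
theorem isLeavittFamily_generators :
    IsLeavittFamily fun g : LeavittGenerator V => mk R V (LeavittFree.of R g) where
  vertex_idem x := mk_eq_of_leavittRel R (.vertex_idem x)
  vertex_orth x y h := mk_eq_of_leavittRel R (.vertex_orth x y h)
  source_edge e := mk_eq_of_leavittRel R (.source_edge e)
  edge_range e := mk_eq_of_leavittRel R (.edge_range e)
  ghost_source e := mk_eq_of_leavittRel R (.ghost_source e)
  range_ghost e := mk_eq_of_leavittRel R (.range_ghost e)
  ghost_edge_self e := mk_eq_of_leavittRel R (.ghost_edge_self e)
  ghost_edge_ne e e' h := mk_eq_of_leavittRel R (.ghost_edge_ne e e' h)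
  vertex_sum x h := by
    have := finite_star_of_not_isSingularVertex h
    exact (mk_eq_of_leavittRel R (.vertex_sum x h)).trans
      (map_finsum (mkHom R V) (Set.toFinite _))

theorem vertex_mul_self (x : V) : vertex R x * vertex R x = vertex R x :=
  (isLeavittFamily_generators R).vertex_idem x

theorem vertex_mul_of_ne {x y : V} (h : x ≠ y) : vertex R x * vertex R y = 0 :=
  (isLeavittFamily_generators R).vertex_orth x y h

theorem vertex_mul_edge (e : Quiver.Total V) : vertex R e.left * edge R e = edge R e :=
  (isLeavittFamily_generators R).source_edge e

theorem edge_mul_vertex (e : Quiver.Total V) : edge R e * vertex R e.right = edge R e :=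
  (isLeavittFamily_generators R).edge_range e

theorem ghost_mul_vertex (e : Quiver.Total V) : ghost R e * vertex R e.left = ghost R e :=
  (isLeavittFamily_generators R).ghost_source e

theorem vertex_mul_ghost (e : Quiver.Total V) : vertex R e.right * ghost R e = ghost R e :=
  (isLeavittFamily_generators R).range_ghost e

theorem ghost_mul_edge_self (e : Quiver.Total V) : ghost R e * edge R e = vertex R e.right :=
  (isLeavittFamily_generators R).ghost_edge_self e

theorem ghost_mul_edge_of_ne {e f : Quiver.Total V} (h : e ≠ f) : ghost R e * edge R f = 0 :=
  (isLeavittFamily_generators R).ghost_edge_ne e f h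

theorem vertex_eq_finsum (x : V) (h : ¬ IsSingularVertex x) :
    vertex R x =
      ∑ᶠ e : Quiver.Star x, edge R ⟨x, e.1, e.2⟩ * ghost R ⟨x, e.1, e.2⟩ :=
  (isLeavittFamily_generators R).vertex_sum x h

/-- `L_R(E)` is generated by the vertices, edges and ghost edges, in the form of an induction
principle: a property holds for all elements if it is stable under linear combinations, holds
for `0` and generators, and is stable under left multiplication by generators. -/
theorem induction_mul_left {P : LeavittPathAlgebra R V → Prop}
    (add : ∀ a b, P a → P b → P (a + b)) (zero : P 0) (smul : ∀ (r : R) a, P a → P (r • a))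
    (generator : ∀ g, P (mk R V (LeavittFree.of R g)))
    (mul : ∀ g a, P a → P (mk R V (LeavittFree.of R g) * a)) (a : LeavittPathAlgebra R V) :
    P a := by
  obtain ⟨a⟩ := a
  change P (mk R V a)
  induction a using MonoidAlgebra.induction_linear with
  | zero => exact zero
  | add x y hx hy => exact add _ _ hx hy
  | single m r =>
    have h (m : FreeSemigroup (LeavittGenerator V)) :
        P (mk R V (MonoidAlgebra.single m 1)) := by
      induction m using FreeSemigroup.recOnMul with
      | ih1 g => exact generator g
      | ih2 g m _ ih =>
        have : (MonoidAlgebra.single (FreeSemigroup.of g * m) (1 : R)) =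
            LeavittFree.of R g * MonoidAlgebra.single m 1 := by
          rw [LeavittFree.of, MonoidAlgebra.single_mul_single, one_mul]
        rw [this]
        exact mul g _ ih
    have : MonoidAlgebra.single m r = r • MonoidAlgebra.single m (1 : R) := by simp
    rw [this]
    exact smul r _ (h m)

end Relations

end LeavittPathAlgebra

/-! ### Vertices are nonzero -/

section Representation

/-- Choose one infinite set `D` that is at least as large as the edge set.  Then for each vertex `x`
that emits edges there is a bijection between `s⁻¹(x) × D` and `D`; the maps `φ e : D → D` are
its restrictions to the edges `e`. -/
theorem exists_edge_decomposition (V : Type u) [Quiver.{v} V] :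
    ∃ (D : Type (max u v)) (_ : Nonempty D) (φ : Quiver.Total V → D → D),
      (∀ e f : Quiver.Total V, ∀ c d : D, e.left = f.left → φ e c = φ f d → e = f ∧ c = d) ∧
      ∀ (x : V) (d : D), ¬ IsSink x → ∃ (e : Quiver.Total V) (c : D), e.left = x ∧ φ e c = d := by
  let D : Type (max u v) := ULift.{max u v} ℕ ⊕ Quiver.Total V
  have hD : Cardinal.aleph0 ≤ Cardinal.mk D := Cardinal.aleph0_le_mk D
  have key : ∀ x : V, ∃ ψ : Quiver.Star x × D → D,
      Function.Injective ψ ∧ (¬ IsSink x → Function.Surjective ψ) := by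
    intro x
    by_cases hx : IsSink x
    · have : IsEmpty (Quiver.Star x) := hx
      exact ⟨fun p => isEmptyElim p.1, fun p => isEmptyElim p.1, fun h => absurd hx h⟩
    · have hne : Nonempty (Quiver.Star x) := not_isEmpty_iff.1 hx
      have hle : Cardinal.mk (Quiver.Star x) ≤ Cardinal.mk D := by
        refine Cardinal.mk_le_of_injective
          (f := fun e : Quiver.Star x => (Sum.inr ⟨x, e.1, e.2⟩ : D)) ?_
        rintro ⟨a, e⟩ ⟨b, f⟩ h
        simpa using Sum.inr.inj h
      have hmul : Cardinal.mk (Quiver.Star x × D) = Cardinal.mk D := by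
        rw [Cardinal.mk_prod, Cardinal.lift_id, Cardinal.lift_id,
          Cardinal.mul_eq_right hD hle (Cardinal.mk_ne_zero _)]
      obtain ⟨ψ⟩ := Cardinal.eq.1 hmul
      exact ⟨ψ, ψ.injective, fun _ => ψ.surjective⟩
  choose ψ hinj hsurj using key
  refine ⟨D, inferInstance, fun e d => ψ e.left (⟨e.right, e.hom⟩, d), ?_, ?_⟩
  · rintro ⟨x, a, e⟩ ⟨y, b, f⟩ c d hxy h
    obtain rfl : x = y := hxy
    simpa using hinj x h
  · intro x d hx
    obtain ⟨⟨⟨a, e⟩, c⟩, h⟩ := hsurj x hx d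
    exact ⟨⟨x, a, e⟩, c, rfl, h⟩

variable (R : Type w) [CommRing R] {V : Type u} [Quiver.{v} V] {D : Type*}

open scoped Classical in
/-- The images of the generators on the free module on `V × D`, given maps `φ e : D → D`: the
vertex `x` is the projection to `{x} × D`, the edge `e` maps `(r(e), d)` to `(s(e), φ e d)`, and
`e*` is the partial inverse of `e`. -/
def branchingFamily (φ : Quiver.Total V → D → D) :
    LeavittGenerator V → Module.End R (V × D →₀ R)
  | .vertex x => Finsupp.lsum R fun y => if y.1 = x then Finsupp.lsingle y else 0
  | .edge e => Finsupp.lsum R fun y =>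
      if y.1 = e.right then Finsupp.lsingle (e.left, φ e y.2) else 0
  | .ghost e => Finsupp.lsum R fun y =>
      if h : ∃ d, (e.left, φ e d) = y then Finsupp.lsingle (e.right, h.choose) else 0

open scoped Classical in
theorem branchingFamily_vertex_single (φ : Quiver.Total V → D → D) (x : V) (y : V × D) (r : R) :
    branchingFamily R φ (.vertex x) (.single y r) = if y.1 = x then .single y r else 0 := by
  simp only [branchingFamily, Finsupp.lsum_single]
  split_ifs <;> simp

open scoped Classical in
theorem branchingFamily_edge_single (φ : Quiver.Total V → D → D) (e : Quiver.Total V)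
    (y : V × D) (r : R) :
    branchingFamily R φ (.edge e) (.single y r) =
      if y.1 = e.right then .single (e.left, φ e y.2) r else 0 := by
  simp only [branchingFamily, Finsupp.lsum_single]
  split_ifs <;> simp

theorem branchingFamily_ghost_single_self {φ : Quiver.Total V → D → D}
    (hφ : ∀ e f : Quiver.Total V, ∀ c d : D, e.left = f.left → φ e c = φ f d → e = f ∧ c = d)
    (e : Quiver.Total V) (d : D) (r : R) :
    branchingFamily R φ (.ghost e) (.single (e.left, φ e d) r) = .single (e.right, d) r := by
  have h : ∃ c, (e.left, φ e c) = (e.left, φ e d) := ⟨d, rfl⟩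
  have hd : h.choose = d := (hφ e e _ _ rfl (Prod.ext_iff.1 h.choose_spec).2).2
  simp only [branchingFamily, Finsupp.lsum_single]
  rw [dif_pos h, hd, Finsupp.lsingle_apply]

theorem branchingFamily_ghost_single_of_ne (φ : Quiver.Total V → D → D)
    (e : Quiver.Total V) {y : V × D} (h : ∀ d, (e.left, φ e d) ≠ y) (r : R) :
    branchingFamily R φ (.ghost e) (.single y r) = 0 := by
  have h' : ¬ ∃ d, (e.left, φ e d) = y := fun ⟨d, hd⟩ => h d hd
  simp only [branchingFamily, Finsupp.lsum_single]
  rw [dif_neg h', LinearMap.zero_apply]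

theorem isLeavittFamily_branchingFamily {φ : Quiver.Total V → D → D}
    (hφ : ∀ e f : Quiver.Total V, ∀ c d : D, e.left = f.left → φ e c = φ f d → e = f ∧ c = d)
    (hs : ∀ (x : V) (d : D), ¬ IsSink x →
      ∃ (e : Quiver.Total V) (c : D), e.left = x ∧ φ e c = d) :
    IsLeavittFamily (branchingFamily R φ) := by
  classical
  -- Each point of `V × D` either lies in the image of a given edge or is killed by its ghost.
  have cases_ghost (e : Quiver.Total V) (y : V × D) :
      (∃ d, (e.left, φ e d) = y) ∨ ∀ r, branchingFamily R φ (.ghost e) (.single y r) = 0 := by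
    by_cases h : ∃ d, (e.left, φ e d) = y
    · exact .inl h
    · exact .inr (branchingFamily_ghost_single_of_ne R φ e fun d hd => h ⟨d, hd⟩)
  constructor
  · intro x
    refine Finsupp.lhom_ext fun y r => ?_
    by_cases h : y.1 = x <;> simp [branchingFamily_vertex_single, h]
  · intro x x' hx
    refine Finsupp.lhom_ext fun y r => ?_
    by_cases h : y.1 = x'
    · simp [branchingFamily_vertex_single, h, hx.symm]
    · simp [branchingFamily_vertex_single, h]
  · intro e
    refine Finsupp.lhom_ext fun y r => ?_
    by_cases h : y.1 = e.right <;>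
      simp [branchingFamily_vertex_single, branchingFamily_edge_single, h]
  · intro e
    refine Finsupp.lhom_ext fun y r => ?_
    by_cases h : y.1 = e.right <;>
      simp [branchingFamily_vertex_single, branchingFamily_edge_single, h]
  · intro e
    refine Finsupp.lhom_ext fun y r => ?_
    rw [Module.End.mul_apply, branchingFamily_vertex_single]
    split_ifs with h
    · rfl
    · rw [map_zero, branchingFamily_ghost_single_of_ne]
      rintro d rfl
      exact h rfl
  · intro e
    refine Finsupp.lhom_ext fun y r => ?_
    rw [Module.End.mul_apply]
    obtain ⟨d, rfl⟩ | h := cases_ghost e y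
    · rw [branchingFamily_ghost_single_self R hφ, branchingFamily_vertex_single, if_pos rfl]
    · rw [h, map_zero]
  · intro e
    refine Finsupp.lhom_ext fun y r => ?_
    rw [Module.End.mul_apply, branchingFamily_edge_single, branchingFamily_vertex_single]
    split_ifs with h
    · rw [branchingFamily_ghost_single_self R hφ, ← h]
    · rw [map_zero]
  · intro e f hef
    refine Finsupp.lhom_ext fun y r => ?_
    rw [Module.End.mul_apply, branchingFamily_edge_single]
    split_ifs with h
    · rw [branchingFamily_ghost_single_of_ne, LinearMap.zero_apply]
      intro d hd
      exact hef (hφ e f _ _ (Prod.ext_iff.1 hd).1 (Prod.ext_iff.1 hd).2).1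
    · rw [map_zero, LinearMap.zero_apply]
  · intro x hx
    have := finite_star_of_not_isSingularVertex hx
    have := Fintype.ofFinite (Quiver.Star x)
    rw [finsum_eq_sum_of_fintype]
    refine Finsupp.lhom_ext fun y r => ?_
    rw [LinearMap.sum_apply, branchingFamily_vertex_single]
    split_ifs with h
    · -- A point over `x` lies in the image of exactly one edge `e`, and `e e*` fixes it.
      obtain ⟨y, d⟩ := y
      obtain rfl : y = x := h
      obtain ⟨⟨y, a, e⟩, c, rfl, rfl⟩ := hs y d fun h => hx (.inl h)
      rw [Finset.sum_eq_single (⟨a, e⟩ : Quiver.Star y)]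
      · rw [Module.End.mul_apply, branchingFamily_ghost_single_self R hφ ⟨y, a, e⟩ c,
          branchingFamily_edge_single, if_pos rfl]
      · rintro ⟨b, f⟩ - hne
        rw [Module.End.mul_apply, branchingFamily_ghost_single_of_ne, map_zero]
        intro d hd
        have := (hφ ⟨y, b, f⟩ ⟨y, a, e⟩ _ _ rfl (Prod.ext_iff.1 hd).2).1
        apply hne
        simpa using this
      · simp
    · refine (Finset.sum_eq_zero fun e _ => ?_).symm
      rw [Module.End.mul_apply, branchingFamily_ghost_single_of_ne, map_zero]
      rintro d rfl
      exact h rfl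

end Representation

namespace LeavittPathAlgebra

theorem vertex_ne_zero (R : Type w) [CommRing R] [Nontrivial R] {V : Type u} [Quiver.{v} V]
    (x : V) : vertex R x ≠ 0 := by
  classical
  obtain ⟨D, ⟨d⟩, φ, hφ, hs⟩ := exists_edge_decomposition V
  intro h
  have h₁ := lift_mk_of (R := R) (isLeavittFamily_branchingFamily R hφ hs) (.vertex x)
  change lift R _ (vertex R x) = _ at h₁
  rw [h, map_zero] at h₁
  have h₂ := branchingFamily_vertex_single R φ x (x, d) (1 : R)
  rw [← h₁, if_pos rfl, LinearMap.zero_apply] at h₂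
  exact one_ne_zero (Finsupp.single_eq_zero.1 h₂.symm)

end LeavittPathAlgebra

namespace LeavittPathAlgebra

/-! ### Multiplication of paths -/

section Paths

variable (R : Type w) [CommRing R] {V : Type u} [Quiver.{v} V]

theorem vertex_mul_ofPath {a b : V} (p : Quiver.Path a b) :
    vertex R a * ofPath R p = ofPath R p := by
  induction p with
  | nil => exact vertex_mul_self R a
  | cons p e ih => rw [ofPath, ← mul_assoc, ih]

theorem ofPath_mul_vertex {a b : V} (p : Quiver.Path a b) :
    ofPath R p * vertex R b = ofPath R p := by
  cases p with
  | nil => exact vertex_mul_self R a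
  | @cons c d p e => rw [ofPath, mul_assoc, edge_mul_vertex R ⟨c, b, e⟩]

theorem vertex_mul_ofPathStar {a b : V} (p : Quiver.Path a b) :
    vertex R b * ofPathStar R p = ofPathStar R p := by
  cases p with
  | nil => exact vertex_mul_self R a
  | @cons c d p e => rw [ofPathStar, ← mul_assoc, vertex_mul_ghost R ⟨c, b, e⟩]

theorem ofPath_comp {a b c : V} (p : Quiver.Path a b) (q : Quiver.Path b c) :
    ofPath R (p.comp q) = ofPath R p * ofPath R q := by
  induction q with
  | nil => exact (ofPath_mul_vertex R p).symm
  | cons q e ih => rw [Quiver.Path.comp_cons, ofPath, ofPath, ih, mul_assoc]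

theorem ofPath_toPath {a b : V} (e : a ⟶ b) : ofPath R e.toPath = edge R ⟨a, b, e⟩ :=
  vertex_mul_edge R ⟨a, b, e⟩

theorem ofPathStar_mul_ofPath {a b : V} (p : Quiver.Path a b) :
    ofPathStar R p * ofPath R p = vertex R b := by
  induction p with
  | nil => exact vertex_mul_self R a
  | @cons c d p e ih =>
    rw [ofPathStar, ofPath, mul_assoc, ← mul_assoc (ofPathStar R p), ih,
      vertex_mul_edge R ⟨c, d, e⟩, ghost_mul_edge_self R ⟨c, d, e⟩]

end Paths

/-! ### Gradings by quotients of the integers -/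

section Grading

variable (R : Type w) [CommRing R] (V : Type u) [Quiver.{v} V] (Ω : AddSubgroup ℤ)

/-- The component of `L_R(E)` of degree `q` in the grading by the quotient group `ℤ ⧸ Ω`. -/
abbrev cosetComponent (q : ℤ ⧸ Ω) : Submodule R (LeavittPathAlgebra R V) :=
  quotientGrading (grading R V) Ω q

theorem cosetComponent_eq_span (q : ℤ ⧸ Ω) :
    cosetComponent R V Ω q = Submodule.span R {z | ∃ (a b c : V) (α : Quiver.Path a c)
      (β : Quiver.Path b c), (((α.length : ℤ) - (β.length : ℤ) : ℤ) : ℤ ⧸ Ω) = q ∧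
        z = ofPath R α * ofPathStar R β} := by
  refine le_antisymm (iSup₂_le fun k hk => Submodule.span_mono ?_) (Submodule.span_le.2 ?_)
  · rintro z ⟨a, b, c, α, β, h, rfl⟩
    exact ⟨a, b, c, α, β, by rw [h, hk], rfl⟩
  · rintro z ⟨a, b, c, α, β, h, rfl⟩
    exact Submodule.mem_iSup_of_mem _ <| Submodule.mem_iSup_of_mem h <|
      Submodule.subset_span ⟨a, b, c, α, β, rfl, rfl⟩

variable {V} in
theorem ofPath_mul_ofPathStar_mem {a b c : V} (α : Quiver.Path a c) (β : Quiver.Path b c)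
    {q : ℤ ⧸ Ω} (h : (((α.length : ℤ) - (β.length : ℤ) : ℤ) : ℤ ⧸ Ω) = q) :
    ofPath R α * ofPathStar R β ∈ cosetComponent R V Ω q := by
  rw [cosetComponent_eq_span]
  exact Submodule.subset_span ⟨a, b, c, α, β, h, rfl⟩

variable {V} in
theorem vertex_mem (x : V) : vertex R x ∈ cosetComponent R V Ω 0 := by
  rw [← vertex_mul_self]
  exact ofPath_mul_ofPathStar_mem R Ω (.nil : Quiver.Path x x) .nil (by simp)

variable {V} in
/-- The degree of a generator: `0` for vertices, `1` for edges and `-1` for ghost edges. -/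
def generatorDegree : LeavittGenerator V → ℤ
  | .vertex _ => 0
  | .edge _ => 1
  | .ghost _ => -1

variable {V}

theorem generator_mul_ofPath_mul_ofPathStar_mem (g : LeavittGenerator V) {a b c : V}
    (α : Quiver.Path a c) (β : Quiver.Path b c) {q : ℤ ⧸ Ω}
    (h : ((generatorDegree g + ((α.length : ℤ) - (β.length : ℤ)) : ℤ) : ℤ ⧸ Ω) = q) :
    mk R V (LeavittFree.of R g) * (ofPath R α * ofPathStar R β) ∈ cosetComponent R V Ω q := by
  cases g with
  | vertex x =>
    change vertex R x * _ ∈ _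
    by_cases hx : x = a
    · subst hx
      rw [← mul_assoc, vertex_mul_ofPath]
      exact ofPath_mul_ofPathStar_mem R Ω α β (by rw [← h, generatorDegree, zero_add])
    · rw [← vertex_mul_ofPath R α, ← mul_assoc, ← mul_assoc, vertex_mul_of_ne R hx, zero_mul,
        zero_mul]
      exact zero_mem _
  | edge e =>
    change edge R e * _ ∈ _
    obtain ⟨x, y, e⟩ := e
    by_cases hy : y = a
    · subst hy
      rw [← mul_assoc, ← ofPath_toPath, ← ofPath_comp]
      refine ofPath_mul_ofPathStar_mem R Ω (e.toPath.comp α) β ?_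
      rw [← h, generatorDegree, Quiver.Path.length_comp, Quiver.Path.length_toPath]
      congr 1
      push_cast
      ring
    · rw [← vertex_mul_ofPath R α, ← edge_mul_vertex, mul_assoc, ← mul_assoc (vertex R _),
        ← mul_assoc (vertex R _), vertex_mul_of_ne R hy, zero_mul, zero_mul, mul_zero]
      exact zero_mem _
  | ghost e =>
    change ghost R e * _ ∈ _
    obtain ⟨x, y, e⟩ := e
    by_cases hα : α.length = 0
    · obtain rfl := α.eq_of_length_zero hα
      obtain rfl := α.eq_nil_of_length_zero hα
      by_cases hx : x = a
      · subst hx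
        have : ghost R ⟨x, y, e⟩ * (ofPath R (.nil : Quiver.Path x x) * ofPathStar R β) =
            ofPath R (.nil : Quiver.Path y y) * ofPathStar R (β.cons e) := by
          rw [ofPath, vertex_mul_ofPathStar, ofPath, vertex_mul_ofPathStar, ofPathStar]
        rw [this]
        refine ofPath_mul_ofPathStar_mem R Ω _ _ ?_
        rw [← h, generatorDegree]
        simp only [Quiver.Path.length_nil, Quiver.Path.length_cons]
        congr 1
        push_cast
        ring
      · rw [ofPath, ← ghost_mul_vertex, mul_assoc, ← mul_assoc (vertex R _),
          vertex_mul_of_ne R hx, zero_mul, mul_zero]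
        exact zero_mem _
    · obtain ⟨d, f, α, rfl, hlen⟩ := α.length_ne_zero_iff_eq_comp.1 hα
      rw [ofPath_comp, ofPath_toPath, ← mul_assoc, ← mul_assoc]
      by_cases hef : (⟨x, y, e⟩ : Quiver.Total V) = ⟨a, d, f⟩
      · rw [hef, ghost_mul_edge_self, vertex_mul_ofPath]
        refine ofPath_mul_ofPathStar_mem R Ω _ _ ?_
        rw [← h, hlen, generatorDegree]
        congr 1
        push_cast
        ring
      · rw [ghost_mul_edge_of_ne R hef, zero_mul, zero_mul]
        exact zero_mem _

theorem generator_mul_mem (g : LeavittGenerator V) {q : ℤ ⧸ Ω} {y : LeavittPathAlgebra R V}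
    (hy : y ∈ cosetComponent R V Ω q) :
    mk R V (LeavittFree.of R g) * y ∈
      cosetComponent R V Ω (((generatorDegree g : ℤ) : ℤ ⧸ Ω) + q) := by
  rw [cosetComponent_eq_span] at hy
  induction hy using Submodule.span_induction with
  | mem y hy =>
    obtain ⟨a, b, c, α, β, rfl, rfl⟩ := hy
    exact generator_mul_ofPath_mul_ofPathStar_mem R Ω g α β rfl
  | zero => rw [mul_zero]; exact zero_mem _
  | add y z _ _ hy hz => rw [mul_add]; exact add_mem hy hz
  | smul r y _ hy => rw [mul_smul_comm]; exact Submodule.smul_mem _ r hy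

theorem ofPath_mul_mem {a b : V} (p : Quiver.Path a b) {q q' : ℤ ⧸ Ω}
    {y : LeavittPathAlgebra R V} (hy : y ∈ cosetComponent R V Ω q)
    (h : ((p.length : ℤ) : ℤ ⧸ Ω) + q = q') : ofPath R p * y ∈ cosetComponent R V Ω q' := by
  subst h
  induction p generalizing q y with
  | nil => exact generator_mul_mem R Ω (.vertex a) hy
  | @cons c d p e ih =>
    rw [ofPath, mul_assoc]
    convert ih (generator_mul_mem R Ω (.edge ⟨c, d, e⟩) hy) using 1
    · rw [Quiver.Path.length_cons, ← add_assoc]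
      rfl
    · rfl

theorem ofPathStar_mul_mem {a b : V} (p : Quiver.Path a b) {q q' : ℤ ⧸ Ω}
    {y : LeavittPathAlgebra R V} (hy : y ∈ cosetComponent R V Ω q)
    (h : ((-(p.length : ℤ) : ℤ) : ℤ ⧸ Ω) + q = q') :
    ofPathStar R p * y ∈ cosetComponent R V Ω q' := by
  subst h
  induction p with
  | nil => exact generator_mul_mem R Ω (.vertex a) hy
  | @cons c d p e ih =>
    rw [ofPathStar, mul_assoc]
    convert generator_mul_mem R Ω (.ghost ⟨c, d, e⟩) ih using 1
    · rw [Quiver.Path.length_cons, ← add_assoc, generatorDegree, ← QuotientAddGroup.mk_add]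
      congr 3
      push_cast
      ring
    · rfl

theorem mul_mem_cosetComponent {q q' : ℤ ⧸ Ω} {x y : LeavittPathAlgebra R V}
    (hx : x ∈ cosetComponent R V Ω q) (hy : y ∈ cosetComponent R V Ω q') :
    x * y ∈ cosetComponent R V Ω (q + q') := by
  rw [cosetComponent_eq_span] at hx
  induction hx using Submodule.span_induction with
  | mem x hx =>
    obtain ⟨a, b, c, α, β, rfl, rfl⟩ := hx
    rw [mul_assoc]
    refine ofPath_mul_mem R Ω α (ofPathStar_mul_mem R Ω β hy rfl) ?_
    rw [← add_assoc, ← QuotientAddGroup.mk_add, sub_eq_add_neg]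
  | zero => rw [zero_mul]; exact zero_mem _
  | add y z _ _ hy hz => rw [add_mul]; exact add_mem hy hz
  | smul r y _ hy => rw [smul_mul_assoc]; exact Submodule.smul_mem _ r hy

theorem exists_generator_mul_vertex (g : LeavittGenerator V) :
    ∃ x : V, mk R V (LeavittFree.of R g) * vertex R x = mk R V (LeavittFree.of R g) := by
  cases g with
  | vertex x => exact ⟨x, vertex_mul_self R x⟩
  | edge e => exact ⟨e.right, edge_mul_vertex R e⟩
  | ghost e => exact ⟨e.left, ghost_mul_vertex R e⟩

theorem iSup_cosetComponent_eq_top : ⨆ q, cosetComponent R V Ω q = ⊤ := by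
  have hmul (g : LeavittGenerator V) (a : LeavittPathAlgebra R V)
      (ha : a ∈ ⨆ q, cosetComponent R V Ω q) :
      mk R V (LeavittFree.of R g) * a ∈ ⨆ q, cosetComponent R V Ω q := by
    induction ha using Submodule.iSup_induction' with
    | mem q a ha => exact Submodule.mem_iSup_of_mem _ (generator_mul_mem R Ω g ha)
    | zero => rw [mul_zero]; exact zero_mem _
    | add a b _ _ ha hb => rw [mul_add]; exact add_mem ha hb
  refine Submodule.eq_top_iff'.2 fun a => ?_
  induction a using induction_mul_left with
  | add a b ha hb => exact add_mem ha hb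
  | zero => exact zero_mem _
  | smul r a ha => exact Submodule.smul_mem _ r ha
  | generator g =>
    obtain ⟨x, hx⟩ := exists_generator_mul_vertex R g
    rw [← hx]
    exact hmul g _ (Submodule.mem_iSup_of_mem 0 (vertex_mem R Ω x))
  | mul g a ha => exact hmul g a ha

variable (V) in
/-- The inclusion `a ↦ a q` of `L_R(E)` into the group algebra of `ℤ ⧸ Ω` over its unitization. -/
def singleInr (q : ℤ ⧸ Ω) : LeavittPathAlgebra R V →ₗ[R]
    AddMonoidAlgebra (Unitization R (LeavittPathAlgebra R V)) (ℤ ⧸ Ω) :=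
  AddMonoidAlgebra.lsingle q ∘ₗ Unitization.inrHom R R (LeavittPathAlgebra R V)

theorem singleInr_apply (q : ℤ ⧸ Ω) (a : LeavittPathAlgebra R V) :
    singleInr R V Ω q a = AddMonoidAlgebra.single q (Unitization.inr a) :=
  rfl

theorem singleInr_mul_singleInr (k l : ℤ ⧸ Ω) (a b : LeavittPathAlgebra R V) :
    singleInr R V Ω k a * singleInr R V Ω l b = singleInr R V Ω (k + l) (a * b) := by
  simp only [singleInr_apply, AddMonoidAlgebra.single_mul_single, Unitization.inr_mul]

/-- The Leavitt family in the group algebra of `ℤ ⧸ Ω` over (the unitization of) `L_R(E)` in which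
each generator is multiplied by the group element of its degree. -/
def degreeFamily (g : LeavittGenerator V) :
    AddMonoidAlgebra (Unitization R (LeavittPathAlgebra R V)) (ℤ ⧸ Ω) :=
  singleInr R V Ω (generatorDegree g : ℤ) (mk R V (LeavittFree.of R g))

theorem isLeavittFamily_degreeFamily :
    IsLeavittFamily (degreeFamily R Ω (V := V)) where
  vertex_idem x := by
    simp only [degreeFamily, singleInr_mul_singleInr, ← QuotientAddGroup.mk_add,
      generatorDegree, add_zero]
    exact congrArg (singleInr R V Ω _) (vertex_mul_self R x)
  vertex_orth x y h := by
    simp only [degreeFamily, singleInr_mul_singleInr, ← QuotientAddGroup.mk_add]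
    exact (congrArg (singleInr R V Ω _) (vertex_mul_of_ne R h)).trans (map_zero _)
  source_edge e := by
    simp only [degreeFamily, singleInr_mul_singleInr, ← QuotientAddGroup.mk_add,
      generatorDegree, zero_add]
    exact congrArg (singleInr R V Ω _) (vertex_mul_edge R e)
  edge_range e := by
    simp only [degreeFamily, singleInr_mul_singleInr, ← QuotientAddGroup.mk_add,
      generatorDegree, add_zero]
    exact congrArg (singleInr R V Ω _) (edge_mul_vertex R e)
  ghost_source e := by
    simp only [degreeFamily, singleInr_mul_singleInr, ← QuotientAddGroup.mk_add,
      generatorDegree, add_zero]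
    exact congrArg (singleInr R V Ω _) (ghost_mul_vertex R e)
  range_ghost e := by
    simp only [degreeFamily, singleInr_mul_singleInr, ← QuotientAddGroup.mk_add,
      generatorDegree, zero_add]
    exact congrArg (singleInr R V Ω _) (vertex_mul_ghost R e)
  ghost_edge_self e := by
    simp only [degreeFamily, singleInr_mul_singleInr, ← QuotientAddGroup.mk_add,
      generatorDegree, neg_add_cancel]
    exact congrArg (singleInr R V Ω _) (ghost_mul_edge_self R e)
  ghost_edge_ne e f h := by
    simp only [degreeFamily, singleInr_mul_singleInr, ← QuotientAddGroup.mk_add]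
    exact (congrArg (singleInr R V Ω _) (ghost_mul_edge_of_ne R h)).trans (map_zero _)
  vertex_sum x h := by
    have := finite_star_of_not_isSingularVertex h
    simp only [degreeFamily, singleInr_mul_singleInr, ← QuotientAddGroup.mk_add,
      generatorDegree, add_neg_cancel]
    exact (congrArg (singleInr R V Ω _) (vertex_eq_finsum R x h)).trans
      (map_finsum (singleInr R V Ω _) (Set.toFinite _))

variable (V) in
/-- The homomorphism `L_R(E) → L_R(E)⁺[ℤ ⧸ Ω]` that multiplies homogeneous elements by the group
element of their degree. -/
def degreeHom : LeavittPathAlgebra R V →ₙₐ[R]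
    AddMonoidAlgebra (Unitization R (LeavittPathAlgebra R V)) (ℤ ⧸ Ω) :=
  lift R (isLeavittFamily_degreeFamily R Ω)

theorem degreeHom_of (g : LeavittGenerator V) :
    degreeHom R V Ω (mk R V (LeavittFree.of R g)) = singleInr R V Ω (generatorDegree g : ℤ)
      (mk R V (LeavittFree.of R g)) :=
  lift_mk_of _ g

theorem degreeHom_ofPath {a b : V} (p : Quiver.Path a b) :
    degreeHom R V Ω (ofPath R p) = singleInr R V Ω (p.length : ℤ) (ofPath R p) := by
  induction p with
  | nil => exact degreeHom_of R Ω (.vertex a)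
  | @cons c d p e ih =>
    have h := degreeHom_of R Ω (.edge ⟨c, d, e⟩)
    rw [ofPath, map_mul, ih]
    refine (congrArg _ h).trans ((singleInr_mul_singleInr ..).trans ?_)
    rfl

theorem degreeHom_ofPathStar {a b : V} (p : Quiver.Path a b) :
    degreeHom R V Ω (ofPathStar R p) =
      singleInr R V Ω (-(p.length : ℤ) : ℤ) (ofPathStar R p) := by
  induction p with
  | nil => exact degreeHom_of R Ω (.vertex a)
  | @cons c d p e ih =>
    have h := degreeHom_of R Ω (.ghost ⟨c, d, e⟩)
    rw [ofPathStar, map_mul, ih]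
    refine (congrArg (· * _) h).trans ((singleInr_mul_singleInr ..).trans ?_)
    rw [generatorDegree, ← QuotientAddGroup.mk_add, Quiver.Path.length_cons]
    have : -1 + -(p.length : ℤ) = -((p.length + 1 : ℕ) : ℤ) := by push_cast; ring
    rw [this]
    rfl

theorem degreeHom_of_mem {q : ℤ ⧸ Ω} {x : LeavittPathAlgebra R V}
    (hx : x ∈ cosetComponent R V Ω q) : degreeHom R V Ω x = singleInr R V Ω q x := by
  rw [cosetComponent_eq_span] at hx
  induction hx using Submodule.span_induction with
  | mem x hx =>
    obtain ⟨a, b, c, α, β, rfl, rfl⟩ := hx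
    rw [map_mul, degreeHom_ofPath, degreeHom_ofPathStar, singleInr_mul_singleInr,
      ← QuotientAddGroup.mk_add, sub_eq_add_neg]
  | zero => rw [map_zero, map_zero]
  | add y z _ _ hy hz => rw [map_add, map_add, hy, hz]
  | smul r y _ hy => rw [map_smul, map_smul, hy]

theorem coeff_singleInr_self (q : ℤ ⧸ Ω) (x : LeavittPathAlgebra R V) :
    (singleInr R V Ω q x).coeff q = Unitization.inr x := by
  simp [singleInr_apply]

theorem coeff_singleInr_of_ne {q q' : ℤ ⧸ Ω} (h : q' ≠ q) (x : LeavittPathAlgebra R V) :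
    (singleInr R V Ω q' x).coeff q = 0 := by
  simp [singleInr_apply, h]

theorem iSupIndep_cosetComponent : iSupIndep (cosetComponent R V Ω) := by
  intro q
  rw [Submodule.disjoint_def]
  intro x hx hx'
  -- The coefficient at `q` of the image of `x` is `x`, and also `0`.
  have h₀ : (degreeHom R V Ω x).coeff q = 0 := by
    clear hx
    induction hx' using Submodule.iSup_induction' with
    | mem q' x hx =>
      by_cases h : q' = q
      · simp only [h, ne_eq, not_true_eq_false, iSup_false, Submodule.mem_bot] at hx
        simp [hx]
      · simp only [ne_eq, h, not_false_eq_true, iSup_pos] at hx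
        rw [degreeHom_of_mem R Ω hx, coeff_singleInr_of_ne R Ω h]
    | zero => simp
    | add x y _ _ hx hy => simp [hx, hy]
  rw [degreeHom_of_mem R Ω hx, coeff_singleInr_self] at h₀
  exact Unitization.inr_injective (h₀.trans (Unitization.inr_zero R).symm)

theorem isAlgebraGrading_cosetComponent : IsAlgebraGrading (cosetComponent R V Ω) :=
  ⟨@DirectSum.isInternal_submodule_of_iSupIndep_of_iSup_eq_top R _ (ℤ ⧸ Ω)
      (fun _ _ => Classical.propDecidable _) _ _ _ _
      (iSupIndep_cosetComponent R Ω) (iSup_cosetComponent_eq_top R Ω),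
    fun _ _ _ hx _ hy => mul_mem_cosetComponent R Ω hx hy⟩

end Grading

end LeavittPathAlgebra

namespace LeavittPathAlgebra

/-! ### Vertices as sums of products of opposite degrees -/

section LocalUnits

variable (R : Type w) [CommRing R] {V : Type u} [Quiver.{v} V] (Ω : AddSubgroup ℤ)

variable (V) in
/-- The additive subgroup generated by the products of elements of degrees `γ` and `δ`. -/
def productSubgroup (γ δ : ℤ ⧸ Ω) : AddSubgroup (LeavittPathAlgebra R V) :=
  AddSubgroup.closure
    {z | ∃ x ∈ cosetComponent R V Ω γ, ∃ y ∈ cosetComponent R V Ω δ, x * y = z}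

variable {R Ω} in
theorem mul_mem_productSubgroup {γ δ : ℤ ⧸ Ω} {x y : LeavittPathAlgebra R V}
    (hx : x ∈ cosetComponent R V Ω γ) (hy : y ∈ cosetComponent R V Ω δ) :
    x * y ∈ productSubgroup R V Ω γ δ :=
  AddSubgroup.subset_closure ⟨x, hx, y, hy, rfl⟩

theorem productSubgroup_le (γ δ : ℤ ⧸ Ω) :
    productSubgroup R V Ω γ δ ≤ (cosetComponent R V Ω (γ + δ)).toAddSubgroup := by
  refine (AddSubgroup.closure_le _).2 ?_
  rintro _ ⟨x, hx, y, hy, rfl⟩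
  exact mul_mem_cosetComponent R Ω hx hy

variable {R Ω} in
theorem smul_mem_productSubgroup {γ δ : ℤ ⧸ Ω} (r : R) {z : LeavittPathAlgebra R V}
    (hz : z ∈ productSubgroup R V Ω γ δ) : r • z ∈ productSubgroup R V Ω γ δ := by
  induction hz using AddSubgroup.closure_induction with
  | mem z hz =>
    obtain ⟨x, hx, y, hy, rfl⟩ := hz
    rw [← smul_mul_assoc]
    exact mul_mem_productSubgroup (Submodule.smul_mem _ r hx) hy
  | zero => rw [smul_zero]; exact zero_mem _
  | add x y _ _ hx hy => rw [smul_add]; exact add_mem hx hy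
  | neg x _ hx => rw [smul_neg]; exact neg_mem hx

variable {R Ω} in
theorem mul_mul_mem_productSubgroup {γ γ' δ δ' : ℤ ⧸ Ω} {x y z : LeavittPathAlgebra R V}
    (hx : x ∈ cosetComponent R V Ω γ') (hy : y ∈ cosetComponent R V Ω δ')
    (hz : z ∈ productSubgroup R V Ω γ δ) :
    x * z * y ∈ productSubgroup R V Ω (γ' + γ) (δ + δ') := by
  induction hz using AddSubgroup.closure_induction with
  | mem z hz =>
    obtain ⟨a, ha, b, hb, rfl⟩ := hz
    rw [← mul_assoc x, mul_assoc (x * a)]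
    exact mul_mem_productSubgroup (mul_mem_cosetComponent R Ω hx ha)
      (mul_mem_cosetComponent R Ω hb hy)
  | zero => rw [mul_zero, zero_mul]; exact zero_mem _
  | add a b _ _ ha hb => rw [mul_add, add_mul]; exact add_mem ha hb
  | neg a _ ha => rw [mul_neg, neg_mul]; exact neg_mem ha

variable {R Ω} in
theorem mul_mem_productSubgroup_of_mem {γ γ' δ δ' : ℤ ⧸ Ω} {u z : LeavittPathAlgebra R V}
    (hu : u ∈ productSubgroup R V Ω γ γ') (hz : z ∈ cosetComponent R V Ω δ')
    (h : γ' + δ' = δ) : u * z ∈ productSubgroup R V Ω γ δ := by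
  subst h
  induction hu using AddSubgroup.closure_induction with
  | mem u hu =>
    obtain ⟨a, ha, b, hb, rfl⟩ := hu
    rw [mul_assoc]
    exact mul_mem_productSubgroup ha (mul_mem_cosetComponent R Ω hb hz)
  | zero => rw [zero_mul]; exact zero_mem _
  | add a b _ _ ha hb => rw [add_mul]; exact add_mem ha hb
  | neg a _ ha => rw [neg_mul]; exact neg_mem ha

/-- Since the vertices are local units, the grading is strong as soon as each vertex is a sum of
products of elements of degrees `γ` and `-γ`, for every `γ`. -/
theorem isStronglyGraded_of_vertex_mem
    (h : ∀ (x : V) (γ : ℤ ⧸ Ω), vertex R x ∈ productSubgroup R V Ω γ (-γ)) :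
    IsStronglyGraded (cosetComponent R V Ω) := by
  refine ⟨isAlgebraGrading_cosetComponent R Ω, fun γ δ => ?_⟩
  refine le_antisymm (productSubgroup_le R Ω γ δ) fun z hz => ?_
  change z ∈ productSubgroup R V Ω γ δ
  change z ∈ cosetComponent R V Ω (γ + δ) at hz
  rw [cosetComponent_eq_span] at hz
  induction hz using Submodule.span_induction with
  | mem z hz =>
    obtain ⟨a, b, c, α, β, hd, rfl⟩ := hz
    rw [← vertex_mul_ofPath R α, mul_assoc]
    exact mul_mem_productSubgroup_of_mem (h a γ) (ofPath_mul_ofPathStar_mem R Ω α β hd)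
      (neg_add_cancel_left γ δ)
  | zero => exact zero_mem _
  | add x y _ _ hx hy => exact add_mem hx hy
  | smul r x _ hx => exact smul_mem_productSubgroup r hx

theorem ofPath_mem {a b : V} (p : Quiver.Path a b) {q : ℤ ⧸ Ω}
    (h : ((p.length : ℤ) : ℤ ⧸ Ω) = q) : ofPath R p ∈ cosetComponent R V Ω q := by
  rw [← ofPath_mul_vertex]
  exact ofPath_mul_ofPathStar_mem R Ω p (.nil : Quiver.Path b b) (by simpa using h)

theorem ofPathStar_mem {a b : V} (p : Quiver.Path a b) {q : ℤ ⧸ Ω}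
    (h : ((-(p.length : ℤ) : ℤ) : ℤ ⧸ Ω) = q) : ofPathStar R p ∈ cosetComponent R V Ω q := by
  rw [← vertex_mul_ofPathStar]
  exact ofPath_mul_ofPathStar_mem R Ω (.nil : Quiver.Path b b) p (by simpa using h)

end LocalUnits

section Residues

variable (R : Type w) [CommRing R] {V : Type u} [Quiver.{v} V] {n : ℕ}

theorem coe_zmultiples_eq_coe_iff {i j : ℤ} :
    ((i : ℤ) : ℤ ⧸ AddSubgroup.zmultiples (n : ℤ)) = (j : ℤ) ↔ (n : ℤ) ∣ j - i := by
  rw [QuotientAddGroup.eq, Int.mem_zmultiples_iff, neg_add_eq_sub]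

theorem exists_natCast_zmultiples_eq (hn : 0 < n) (q : ℤ ⧸ AddSubgroup.zmultiples (n : ℤ)) :
    ∃ k : ℕ, ((k : ℤ) : ℤ ⧸ AddSubgroup.zmultiples (n : ℤ)) = q := by
  obtain ⟨i, rfl⟩ := QuotientAddGroup.mk_surjective q
  refine ⟨(i % n).toNat, coe_zmultiples_eq_coe_iff.2 ?_⟩
  rw [Int.toNat_of_nonneg (Int.emod_nonneg i (by omega))]
  exact Int.dvd_self_sub_emod

/-- The sufficiency of the condition on paths, at the level of vertices.  A regular vertex is the
sum of the `e e*`, and a singular vertex is `α* α` for a path `α` of length `n - 1`; modulo `n`,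
the factors have the degrees `1` and `-1` in both cases. -/
theorem vertex_mem_productSubgroup (hn : 0 < n)
    (h : ∀ x : V, IsSingularVertex x → ∃ (a : V) (α : Quiver.Path a x), α.length = n - 1)
    (x : V) (k : ℕ) :
    vertex R x ∈ productSubgroup R V (AddSubgroup.zmultiples (n : ℤ))
      ((k : ℤ) : ℤ ⧸ AddSubgroup.zmultiples (n : ℤ))
      (-((k : ℤ) : ℤ ⧸ AddSubgroup.zmultiples (n : ℤ))) := by
  induction k generalizing x with
  | zero =>
    rw [← vertex_mul_self R x]
    refine mul_mem_productSubgroup (vertex_mem R _ x) ?_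
    rw [Nat.cast_zero, QuotientAddGroup.mk_zero, neg_zero]
    exact vertex_mem R _ x
  | succ k ih =>
    have step {a y : LeavittPathAlgebra R V} {b : V}
        (ha : a ∈ cosetComponent R V (AddSubgroup.zmultiples (n : ℤ)) ((1 : ℤ) : ℤ ⧸ _))
        (hy : y ∈ cosetComponent R V (AddSubgroup.zmultiples (n : ℤ)) ((-1 : ℤ) : ℤ ⧸ _)) :
        a * vertex R b * y ∈ productSubgroup R V (AddSubgroup.zmultiples (n : ℤ))
          (((k + 1 : ℕ) : ℤ) : ℤ ⧸ _) (-(((k + 1 : ℕ) : ℤ) : ℤ ⧸ _)) := by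
      convert mul_mul_mem_productSubgroup ha hy (ih b) using 1
      rw [← QuotientAddGroup.mk_neg, ← QuotientAddGroup.mk_neg, ← QuotientAddGroup.mk_add,
        ← QuotientAddGroup.mk_add, Nat.cast_succ, neg_add, add_comm (1 : ℤ)]
    by_cases hx : IsSingularVertex x
    · obtain ⟨a, α, hα⟩ := h x hx
      rw [← ofPathStar_mul_ofPath R α, ← vertex_mul_ofPath R α, ← mul_assoc]
      refine step (ofPathStar_mem R _ α ?_) (ofPath_mem R _ α ?_) <;>
        rw [coe_zmultiples_eq_coe_iff, hα]
      · exact ⟨1, by omega⟩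
      · exact ⟨-1, by omega⟩
    · have := finite_star_of_not_isSingularVertex hx
      have := Fintype.ofFinite (Quiver.Star x)
      rw [vertex_eq_finsum R x hx, finsum_eq_sum_of_fintype]
      refine sum_mem fun e _ => ?_
      rw [← edge_mul_vertex]
      refine step ?_ ?_
      · rw [← ofPath_toPath]
        exact ofPath_mem R _ _ rfl
      · have := ofPathStar_mem R (AddSubgroup.zmultiples (n : ℤ)) e.2.toPath rfl
        change ghost R ⟨x, e.1, e.2⟩ * vertex R x ∈ _ at this
        rwa [ghost_mul_vertex R ⟨x, e.1, e.2⟩] at this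

end Residues

/-! ### The obstruction at a singular vertex -/

section Obstruction

variable {R : Type w} [CommRing R] {V : Type u} [Quiver.{v} V] {n : ℕ}

variable (R) in
/-- The elements that are annihilated on the left by the ghosts of all but finitely many of the
edges that leave `x`, and by `x` itself if `x` is a sink. -/
def cofiniteAnnihilated (x : V) : Submodule R (LeavittPathAlgebra R V) where
  carrier := {y | (∃ S : Set (Quiver.Total V), S.Finite ∧
    ∀ e ∉ S, e.left = x → ghost R e * y = 0) ∧ (IsSink x → vertex R x * y = 0)}
  zero_mem' := ⟨⟨∅, Set.finite_empty, fun _ _ _ => mul_zero _⟩, fun _ => mul_zero _⟩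
  add_mem' := by
    rintro y z ⟨⟨S, hS, hy⟩, hy'⟩ ⟨⟨T, hT, hz⟩, hz'⟩
    refine ⟨⟨S ∪ T, hS.union hT, fun e he hex => ?_⟩, fun hs => ?_⟩
    · rw [mul_add, hy e (fun h => he (.inl h)) hex, hz e (fun h => he (.inr h)) hex, add_zero]
    · rw [mul_add, hy' hs, hz' hs, add_zero]
  smul_mem' := by
    rintro r y ⟨⟨S, hS, hy⟩, hy'⟩
    refine ⟨⟨S, hS, fun e he hex => ?_⟩, fun hs => ?_⟩
    · rw [mul_smul_comm, hy e he hex, smul_zero]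
    · rw [mul_smul_comm, hy' hs, smul_zero]

theorem mul_mem_cofiniteAnnihilated {x : V} {y : LeavittPathAlgebra R V}
    (hy : y ∈ cofiniteAnnihilated R x) (z : LeavittPathAlgebra R V) :
    y * z ∈ cofiniteAnnihilated R x := by
  obtain ⟨⟨S, hS, h⟩, h'⟩ := hy
  refine ⟨⟨S, hS, fun e he hex => ?_⟩, fun hs => ?_⟩
  · rw [← mul_assoc, h e he hex, zero_mul]
  · rw [← mul_assoc, h' hs, zero_mul]

theorem vertex_notMem_cofiniteAnnihilated [Nontrivial R] {x : V} (hs : IsSingularVertex x) :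
    vertex R x ∉ cofiniteAnnihilated R x := by
  rintro ⟨⟨S, hS, h₁⟩, h₂⟩
  rcases hs with hs | hs
  · exact vertex_ne_zero R x ((vertex_mul_self R x).symm.trans (h₂ hs))
  · -- Since `S` is finite, some edge `e` that leaves `x` satisfies `e* = e* x = 0`.
    have : Infinite (Quiver.Star x) := hs
    let i : Quiver.Star x → Quiver.Total V := fun e => ⟨x, e.1, e.2⟩
    have hi : Function.Injective i := by
      rintro ⟨a, e⟩ ⟨b, f⟩ hef
      simpa [i] using hef
    obtain ⟨e, he⟩ := (hS.preimage hi.injOn).exists_notMem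
    have h₃ : ghost R (i e) = 0 := by
      rw [← ghost_mul_vertex]
      exact h₁ (i e) he rfl
    refine vertex_ne_zero R e.1 ?_
    rw [← ghost_mul_edge_self R (i e), h₃, zero_mul]

/-- If the vertex `x` receives no path of length `n - 1`, then an element of degree `1` modulo `n` is
a combination of products `α β*` in which `α` is not the vertex `x`: otherwise `β` would end at `x`
and have length `≡ -1` modulo `n`.  If `α` starts with an edge `f`, then `e* α = 0` for all edges
`e ≠ f`; if `α` is a vertex other than `x`, then `x α = 0`. -/
theorem cosetComponent_one_le_cofiniteAnnihilated (hn : 0 < n) {x : V}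
    (hx : ∀ (a : V) (α : Quiver.Path a x), α.length ≠ n - 1) :
    cosetComponent R V (AddSubgroup.zmultiples (n : ℤ)) ((1 : ℤ) : ℤ ⧸ _) ≤
      cofiniteAnnihilated R x := by
  rw [cosetComponent_eq_span, Submodule.span_le]
  rintro y ⟨a, b, c, α, β, hd, rfl⟩
  rw [coe_zmultiples_eq_coe_iff] at hd
  by_cases hα : α.length = 0
  · obtain rfl := α.eq_of_length_zero hα
    obtain rfl := α.eq_nil_of_length_zero hα
    have hxa : x ≠ a := by
      rintro rfl
      -- Here `|α| = 0`, so `n` divides `|β| + 1`.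
      have hle : n - 1 ≤ β.length := by
        have : (n : ℤ) ∣ ((β.length + 1 : ℕ) : ℤ) := by
          convert hd using 1
          simp only [Quiver.Path.length_nil]
          push_cast
          ring
        have := Nat.le_of_dvd (by omega) (Int.natCast_dvd_natCast.1 this)
        omega
      obtain ⟨d, p, q, rfl, hp⟩ :=
        β.exists_eq_comp_of_le_length (n := β.length - (n - 1)) (by omega)
      refine hx d q ?_
      rw [Quiver.Path.length_comp] at hp hle
      omega
    have h0 : vertex R x * (ofPath R (.nil : Quiver.Path a a) * ofPathStar R β) = 0 := by
      rw [ofPath, ← mul_assoc, vertex_mul_of_ne R hxa, zero_mul]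
    refine ⟨⟨∅, Set.finite_empty, ?_⟩, fun _ => h0⟩
    rintro e - rfl
    rw [← ghost_mul_vertex, mul_assoc, h0, mul_zero]
  · obtain ⟨d, f, α, rfl, -⟩ := α.length_ne_zero_iff_eq_comp.1 hα
    rw [ofPath_comp, ofPath_toPath, mul_assoc]
    refine ⟨⟨{⟨a, d, f⟩}, Set.finite_singleton _, ?_⟩, fun hs => ?_⟩
    · intro e he _
      rw [← mul_assoc, ghost_mul_edge_of_ne R he, zero_mul]
    · have hxa : x ≠ a := by
        rintro rfl
        exact hs.false ⟨d, f⟩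
      rw [← vertex_mul_edge R ⟨a, d, f⟩, mul_assoc, ← mul_assoc (vertex R x),
        vertex_mul_of_ne R hxa, zero_mul]

theorem vertex_notMem_productSubgroup [Nontrivial R] (hn : 0 < n) {x : V}
    (hs : IsSingularVertex x) (hx : ∀ (a : V) (α : Quiver.Path a x), α.length ≠ n - 1)
    (δ : ℤ ⧸ AddSubgroup.zmultiples (n : ℤ)) :
    vertex R x ∉ productSubgroup R V (AddSubgroup.zmultiples (n : ℤ)) ((1 : ℤ) : ℤ ⧸ _) δ := by
  have hle : productSubgroup R V (AddSubgroup.zmultiples (n : ℤ)) ((1 : ℤ) : ℤ ⧸ _) δ ≤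
      (cofiniteAnnihilated R x).toAddSubgroup := by
    refine (AddSubgroup.closure_le _).2 ?_
    rintro _ ⟨y, hy, z, -, rfl⟩
    exact mul_mem_cofiniteAnnihilated (cosetComponent_one_le_cofiniteAnnihilated hn hx hy) z
  exact fun h => vertex_notMem_cofiniteAnnihilated hs (hle h)

end Obstruction

end LeavittPathAlgebra

end

theorem proposition4p3 {R : Type w} [CommRing R] [Nontrivial R] {V : Type u} [Quiver.{v} V]
    (n : ℕ) (hn : 0 < n) :
    IsStronglyGraded
        (quotientGrading (LeavittPathAlgebra.grading R V) (AddSubgroup.zmultiples (n : ℤ))) ↔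
      ∀ x : V, IsSingularVertex x →
        ∃ (a : V) (α : Quiver.Path a x), α.length = n - 1 := by
  constructor
  · intro h x hs
    by_contra! hx
    refine LeavittPathAlgebra.vertex_notMem_productSubgroup (R := R) hn hs hx (-((1 : ℤ) : ℤ ⧸ _)) ?_
    have h₁ := LeavittPathAlgebra.vertex_mem R (AddSubgroup.zmultiples (n : ℤ)) x
    rw [← add_neg_cancel ((1 : ℤ) : ℤ ⧸ AddSubgroup.zmultiples (n : ℤ))] at h₁
    exact (h.2 _ _).ge h₁
  · intro h
    refine LeavittPathAlgebra.isStronglyGraded_of_vertex_mem R _ fun x γ => ?_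
    obtain ⟨k, rfl⟩ := LeavittPathAlgebra.exists_natCast_zmultiples_eq hn γ
    exact LeavittPathAlgebra.vertex_mem_productSubgroup R hn h x k
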